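/- An algebraic theory $\mathcal T$ is a single-sorted theory whose language has only finitary function symbols and whose axioms are equations between terms. It is a Malcev theory if there is a term $\mu$ in three variables such that $\mu(x,x,y)=y$ and $\mu(x,y,y)=x$ follow from the axioms. A simplicial algebra of $\mathcal T$ is a functor from $\Delta^{op}$ to the category of models of $\mathcal T$ (the empty model is allowed when it exists). It is called a Kan complex of one of the kinds below if its underlying simplicial set is one. Write $d_k:\Delta^{n}\to\Delta^{n+1}$ and $s_j:\Delta^{n+1}\to\Delta^{n}$ for the face and degeneracy maps, and $\iota:\Lambda^n_m\hookrightarrow\Delta^n$ ($n\ge 1$, $0\le m\le n$) for the horn inclusions. For a map $\alpha:X\to Y$ of simplicial sets, a lifting problem is a pair $x:\Lambda^n_m\to X$, $y:\Delta^n\to Y$ with $\alpha x=y\iota$; a solution of it is a map $l:\Delta^n\to X$ with $l\iota=x$ and $\alpha l=y$. The map $\alpha$ is a Kan fibration if every lifting problem has a solution. A functional Kan fibration is a map $\alpha$ with a function $\mathrm{lift}$ that assigns to each lifting problem a solution $\mathrm{lift}(x,y)$. * A degenerate-preferring Kan fibration is a functional Kan fibration such that $\mathrm{lift}(x,y)$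 is of the form $z\circ s_j$ whenever the lifting problem $(x,y)$ has a solution of this form. * For $0\le m,j\le n$ let $m^*$ be $m$ if $m<j$, either of $m,m+1$ if $m=j$, and $m+1$ if $m>j$. Given a solution $\mathrm{lift}(x,y)$, let $s_j^*(x):\Lambda^{n+1}_{m^*}\to X$ be the map whose restriction to a face $d_k$, $k\ne m^*$, is $\mathrm{lift}(x,y)$ if $k\in\{j,j+1\}$ and $x\circ s_j\circ d_k$ otherwise (where $s_j\circ d_k$ factors through $\Lambda^n_m$). A symmetric effective Kan fibration is a functional Kan fibration such that $\mathrm{lift}(s_j^*(x),y\circ s_j)=\mathrm{lift}(x,y)\circ s_j$ for all lifting problems $(x,y)$, all $j$ and all $m^*$. * A signed horn inclusion is a horn inclusion $\Lambda^n_m\hookrightarrow\Delta^n$ with a sign $\pm\in\{+,-\}$, which has to be $-$ if $m=0$ and $+$ if $m=n$. An effective Kan fibration is a map $\alpha$ with functions $\mathrm{lift}_+$ and $\mathrm{lift}_-$, where $\mathrm{lift}_\pm$ assigns a solution to each lifting problem for a signed horn inclusion with sign $\pm$, such that $\mathrm{lift}_\pm(\mathrm{lift}_\pm(x,y)\circ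 s_j\circ\iota^*,\,y\circ s_j)=\mathrm{lift}_\pm(x,y)\circ s_j$ for all signed horn inclusions, all lifting problems $(x,y)$, all $j$ and all $m^*$ as above, with $\iota^*:\Lambda^{n+1}_{m^*}\hookrightarrow\Delta^{n+1}$. * A uniform Kan fibration is a map $\alpha$ with a choice of solutions to all lifting problems against $\alpha$ of the pushout-products $(B\times\{e\})\cup(A\times\Delta^1)\to B\times\Delta^1$, for every monomorphism $i:A\to B$ of simplicial sets and each endpoint $e\in\{0,1\}$ of $\Delta^1$, such that for every pullback square from a monomorphism $i':A'\to B'$ to $i:A\to B$ with bottom map $b:B'\to B$, the chosen solution of the restricted lifting problem is the chosen solution of the original one precomposed with $b\times\Delta^1$. A simplicial set $X$ is a Kan complex (degenerate-preferring, uniform, symmetric effective, effective Kan complex) if the map from $X$ to the terminal simplicial set is (respectively: can be given the structure of) a Kan fibration of that kind. **Theorem.** Let $\mathcal T$ be an algebraic theory. The following are equivalent: 1. $\mathcal T$ is a Malcev theory. 2. All simplicial algebras of $\mathcal T$ are degenerate-preferring Kan complexes. 3. All simplicial algebras of $\mathcal T$ are Kan complexes. 4. All simplicial algebras of $\mathcal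 T$ are uniform Kan complexes. 5. All simplicial algebras of $\mathcal T$ are symmetric effective Kan complexes. 6. All simplicial algebras of $\mathcal T$ are effective Kan complexes. -/

import Mathlib

open CategoryTheory MonoidalCategory Limits

universe u w

/-! ## Algebraic theories, their models, and Malcev theories -/

/-- A (single-sorted, finitary) algebraic theory: a language having only function symbols, and
axioms that are equations between terms (with variables taken from `ℕ`). -/
structure AlgebraicTheory : Type (u + 1) where
  /-- The language of the theory. -/
  language : FirstOrder.Language.{u, 0}
  /-- There are no relation symbols. -/
  isAlgebraic : language.IsAlgebraic
  /-- The axioms; the pair `(s, t)` stands for the equation `s = t`. -/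
  axms : Set (language.Term ℕ × language.Term ℕ)

namespace AlgebraicTheory

/-- Equational deduction: `T.Derivable s t` says that the equation `s = t` between terms
with variables in `α` is a consequence of the axioms of `T`. -/
inductive Derivable (T : AlgebraicTheory.{u}) {α : Type} :
    T.language.Term α → T.language.Term α → Prop where
  | ax : ∀ e ∈ T.axms, ∀ f : ℕ → T.language.Term α, Derivable T (e.1.subst f) (e.2.subst f)
  | refl : ∀ t : T.language.Term α, Derivable T t t
  | symm : ∀ {s t : T.language.Term α}, Derivable T s t → Derivable T t s
  | trans : ∀ {r s t : T.language.Term α}, Derivable T r s → Derivable T s t → Derivable T r t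
  | congr : ∀ {n : ℕ} (f : T.language.Functions n) (s t : Fin n → T.language.Term α),
      (∀ i, Derivable T (s i) (t i)) →
      Derivable T (FirstOrder.Language.Term.func f s) (FirstOrder.Language.Term.func f t)

/-- `T` is a Malcev theory: there is a ternary operation of the theory, i.e. a term `μ` in three
variables, for which `μ(x, x, y) = y` and `μ(x, y, y) = x` hold in `T`. -/
def IsMalcev (T : AlgebraicTheory.{u}) : Prop :=
  ∃ μ : T.language.Term (Fin 3),
    T.Derivable (α := Fin 2) (μ.subst ![.var 0, .var 0, .var 1]) (.var 1) ∧
    T.Derivable (α := Fin 2) (μ.subst ![.var 0, .var 1, .var 1]) (.var 0)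

/-- A model of `T`, also called a `T`-algebra (possibly empty). -/
structure Algebra (T : AlgebraicTheory.{u}) : Type (max u (w + 1)) where
  /-- The underlying set. -/
  carrier : Type w
  /-- The interpretation of the operations. -/
  [str : T.language.Structure carrier]
  /-- All axioms hold. -/
  holds : ∀ e ∈ T.axms, ∀ v : ℕ → carrier, e.1.realize v = e.2.realize v

attribute [instance] Algebra.str

/-- The category of `T`-algebras and homomorphisms. -/
instance (T : AlgebraicTheory.{u}) : Category.{w} (Algebra.{u, w} T) where
  Hom A B := T.language.Hom A.carrier B.carrier
  id A := FirstOrder.Language.Hom.id T.language A.carrier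
  comp f g := FirstOrder.Language.Hom.comp g f

/-- The forgetful functor from `T`-algebras to sets. -/
def forgetAlgebra (T : AlgebraicTheory.{u}) : Algebra.{u, w} T ⥤ Type w where
  obj A := A.carrier
  map {A B} f := ↾(f : T.language.Hom A.carrier B.carrier).toFun

/-- A simplicial `T`-algebra. -/
abbrev SimplicialAlgebra (T : AlgebraicTheory.{u}) := SimplicialObject (Algebra.{u, w} T)

/-- The underlying simplicial set of a simplicial `T`-algebra. -/
def underlying {T : AlgebraicTheory.{u}} (X : SimplicialAlgebra.{u, w} T) : SSet.{w} :=
  ((SimplicialObject.whiskering _ _).obj (forgetAlgebra T)).obj X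

end AlgebraicTheory

namespace KanNotions

open Simplicial

variable {X Y : SSet.{w}}

/-! ## Functional and degenerate-preferring Kan fibrations -/

/-- A functional Kan fibration: a map `α` together with a function choosing a lift for every
lifting problem of a horn inclusion against `α`. -/
structure FunctionalKanFibration (α : X ⟶ Y) where
  /-- The chosen lift. -/
  lift : ∀ {n : ℕ} (m : Fin (n + 2)) (x : (Λ[n + 1, m] : SSet.{w}) ⟶ X) (y : Δ[n + 1] ⟶ Y),
    x ≫ α = Λ[n + 1, m].ι ≫ y → (Δ[n + 1] ⟶ X)
  ι_lift : ∀ {n : ℕ} (m : Fin (n + 2)) (x : (Λ[n + 1, m] : SSet.{w}) ⟶ X) (y : Δ[n + 1] ⟶ Y)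
    (h : x ≫ α = Λ[n + 1, m].ι ≫ y), Λ[n + 1, m].ι ≫ lift m x y h = x
  lift_comp : ∀ {n : ℕ} (m : Fin (n + 2)) (x : (Λ[n + 1, m] : SSet.{w}) ⟶ X) (y : Δ[n + 1] ⟶ Y)
    (h : x ≫ α = Λ[n + 1, m].ι ≫ y), lift m x y h ≫ α = y

/-- Whenever some solution of a lifting problem has the form `z ∘ s_j`, the chosen lift is of
this form. -/
def FunctionalKanFibration.IsDegeneratePreferring {α : X ⟶ Y}
    (F : FunctionalKanFibration α) : Prop :=
  ∀ {n : ℕ} (m : Fin (n + 2)) (x : (Λ[n + 1, m] : SSet.{w}) ⟶ X) (y : Δ[n + 1] ⟶ Y)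
    (h : x ≫ α = Λ[n + 1, m].ι ≫ y),
    (∃ (j : Fin (n + 1)) (z : Δ[n] ⟶ X),
      Λ[n + 1, m].ι ≫ SSet.stdSimplex.σ j ≫ z = x ∧ (SSet.stdSimplex.σ j ≫ z) ≫ α = y) →
    ∃ (j : Fin (n + 1)) (z : Δ[n] ⟶ X), F.lift m x y h = SSet.stdSimplex.σ j ≫ z

/-! ## Symmetric effective Kan fibrations -/

/-- The indices `m*` of the horns obtained by pulling back the `m`-th horn along `s_j`:
`m* = m` if `m < j`, `m* ∈ {m, m + 1}` if `m = j`, and `m* = m + 1` if `m > j`. -/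
def IsPullbackIndex {n : ℕ} (m j : Fin (n + 2)) (m' : Fin (n + 3)) : Prop :=
  (m < j ∧ m' = m.castSucc) ∨ (m = j ∧ (m' = m.castSucc ∨ m' = m.succ)) ∨
    (j < m ∧ m' = m.succ)

/-- For `x : Λ[n + 1, m] ⟶ X` and an extension `l : Δ[n + 1] ⟶ X` of `x`, the map `x'` on the
horn `Λ[n + 2, m']` is `s_j^*(x)`: on the faces `d_j`, `d_{j+1}` that belong to the horn it is `l`,
and on every other face `d_k` it is `x` composed with the factorisation `g` of `s_j ∘ d_k` through
the horn `Λ[n + 1, m]`. -/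
structure IsPulledBackHorn {n : ℕ} {m : Fin (n + 2)} (x : (Λ[n + 1, m] : SSet.{w}) ⟶ X)
    (l : Δ[n + 1] ⟶ X) (j : Fin (n + 2)) {m' : Fin (n + 3)}
    (x' : (Λ[n + 2, m'] : SSet.{w}) ⟶ X) : Prop where
  face_new : ∀ (k : Fin (n + 3)) (hk : k ≠ m'), k = j.castSucc ∨ k = j.succ →
    SSet.horn.ι m' k hk ≫ x' = l
  face_old : ∀ (k : Fin (n + 3)) (hk : k ≠ m'), k ≠ j.castSucc → k ≠ j.succ →
    ∃ g : Δ[n + 1] ⟶ (Λ[n + 1, m] : SSet.{w}),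
      g ≫ Λ[n + 1, m].ι = SSet.stdSimplex.δ k ≫ SSet.stdSimplex.σ j ∧ SSet.horn.ι m' k hk ≫ x' = g ≫ x

theorem val_predAbove {n : ℕ} (j : Fin (n + 2)) (k : Fin (n + 3)) :
    ((j.predAbove k : Fin (n + 2)) : ℕ) = if (j : ℕ) < k then (k : ℕ) - 1 else k := by
  simp only [Fin.predAbove, Fin.lt_def, Fin.val_castSucc]
  split_ifs <;> simp

/-- `s_j^*(x)` exists and is unique: it is the restriction of `l ∘ s_j` to the horn. -/
theorem isPulledBackHorn_iff {n : ℕ} {m : Fin (n + 2)} {x : (Λ[n + 1, m] : SSet.{w}) ⟶ X}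
    {l : Δ[n + 1] ⟶ X} (hl : Λ[n + 1, m].ι ≫ l = x) {j : Fin (n + 2)} {m' : Fin (n + 3)}
    (hm : IsPullbackIndex m j m') (x' : (Λ[n + 2, m'] : SSet.{w}) ⟶ X) :
    IsPulledBackHorn x l j x' ↔ x' = Λ[n + 2, m'].ι ≫ SSet.stdSimplex.σ j ≫ l := by
  have hfac : ∀ (k : Fin (n + 3)), k ≠ m' → k ≠ j.castSucc → k ≠ j.succ →
      ∃ g : Δ[n + 1] ⟶ (Λ[n + 1, m] : SSet.{w}),
        g ≫ Λ[n + 1, m].ι = SSet.stdSimplex.δ k ≫ SSet.stdSimplex.σ j := by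
    intro k hk h1 h2
    refine ⟨SSet.Subcomplex.lift (SSet.stdSimplex.δ k ≫ SSet.stdSimplex.σ j) ?_,
      SSet.Subcomplex.lift_ι _ _⟩
    rw [SSet.Subcomplex.range_eq_ofSimplex, SSet.Subcomplex.ofSimplex_le_iff,
      SSet.mem_horn_iff_notMem_range]
    refine ⟨j.predAbove k, ?_, ?_⟩
    · have e1 := val_predAbove j k
      simp only [IsPullbackIndex, Fin.ext_iff, Fin.lt_def, ne_eq, Fin.val_castSucc,
        Fin.val_succ] at hm hk h1 h2 ⊢
      split_ifs at e1 <;> omega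
    · rintro ⟨i, hi⟩
      replace hi : ((j.predAbove (k.succAbove i) : Fin (n + 2)) : ℕ) = j.predAbove k :=
        congrArg Fin.val hi
      have e2 : ((k.succAbove i : Fin (n + 3)) : ℕ) = if (i : ℕ) < k then (i : ℕ) else i + 1 := by
        simp only [Fin.succAbove, Fin.lt_def, Fin.val_castSucc]
        split_ifs <;> simp
      rw [val_predAbove, val_predAbove] at hi
      simp only [Fin.ext_iff, ne_eq, Fin.val_castSucc, Fin.val_succ] at h1 h2
      split_ifs at hi e2 <;> omega
  constructor
  · intro h
    refine SSet.horn.hom_ext' (fun k hk => ?_)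
    rw [SSet.horn.ι_ι_assoc]
    by_cases h1 : k = j.castSucc
    · subst h1
      rw [h.face_new _ hk (Or.inl rfl), CosimplicialObject.δ_comp_σ_self_assoc]
    by_cases h2 : k = j.succ
    · subst h2
      rw [h.face_new _ hk (Or.inr rfl), CosimplicialObject.δ_comp_σ_succ_assoc]
    obtain ⟨g, hg, hg'⟩ := h.face_old k hk h1 h2
    rw [hg', ← hl, ← Category.assoc, hg, Category.assoc]
  · rintro rfl
    constructor
    · rintro k hk (rfl | rfl)
      · rw [SSet.horn.ι_ι_assoc, CosimplicialObject.δ_comp_σ_self_assoc]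
      · rw [SSet.horn.ι_ι_assoc, CosimplicialObject.δ_comp_σ_succ_assoc]
    · intro k hk h1 h2
      obtain ⟨g, hg⟩ := hfac k hk h1 h2
      refine ⟨g, hg, ?_⟩
      rw [SSet.horn.ι_ι_assoc, ← Category.assoc, ← hg, Category.assoc, hl]

/-- `s_j^*(x)` and `y ∘ s_j` form again a lifting problem. -/
theorem IsPulledBackHorn.comm {n : ℕ} {m : Fin (n + 2)} {x : (Λ[n + 1, m] : SSet.{w}) ⟶ X}
    {l : Δ[n + 1] ⟶ X} (hl : Λ[n + 1, m].ι ≫ l = x) {j : Fin (n + 2)} {m' : Fin (n + 3)}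
    (hm : IsPullbackIndex m j m') {x' : (Λ[n + 2, m'] : SSet.{w}) ⟶ X}
    (hx' : IsPulledBackHorn x l j x') {α : X ⟶ Y} {y : Δ[n + 1] ⟶ Y} (hy : l ≫ α = y) :
    x' ≫ α = Λ[n + 2, m'].ι ≫ SSet.stdSimplex.σ j ≫ y := by
  rw [(isPulledBackHorn_iff hl hm x').1 hx', ← hy, Category.assoc, Category.assoc]

/-- The condition `lift(s_j^*(x), y ∘ s_j) = lift(x, y) ∘ s_j`, for all `j` and `m*`. -/
def FunctionalKanFibration.IsSymmetricEffective {α : X ⟶ Y}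
    (F : FunctionalKanFibration α) : Prop :=
  ∀ {n : ℕ} (m : Fin (n + 2)) (x : (Λ[n + 1, m] : SSet.{w}) ⟶ X) (y : Δ[n + 1] ⟶ Y)
    (h : x ≫ α = Λ[n + 1, m].ι ≫ y) (j : Fin (n + 2)) (m' : Fin (n + 3))
    (hm : IsPullbackIndex m j m') (x' : (Λ[n + 2, m'] : SSet.{w}) ⟶ X)
    (hx' : IsPulledBackHorn x (F.lift m x y h) j x'),
    F.lift m' x' (SSet.stdSimplex.σ j ≫ y)
      (hx'.comm (F.ι_lift m x y h) hm (F.lift_comp m x y h)) =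
    SSet.stdSimplex.σ j ≫ F.lift m x y h

/-! ## Effective Kan fibrations -/

/-- The sign of a signed horn inclusion. -/
inductive HornSign : Type
  /-- The sign `+`. -/
  | plus : HornSign
  /-- The sign `-`. -/
  | minus : HornSign

/-- The horn inclusion `Λ[n + 1, m] ⟶ Δ[n + 1]` with the sign `s` is a signed horn inclusion:
if `m = 0` the sign is `-`, and if `m = n + 1` the sign is `+`. -/
def IsSignedHorn (s : HornSign) {n : ℕ} (m : Fin (n + 2)) : Prop :=
  (m = 0 → s = HornSign.minus) ∧ (m = Fin.last (n + 1) → s = HornSign.plus)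

/-- Pulling back along `s_j` preserves signed horn inclusions. -/
theorem IsSignedHorn.pullback {s : HornSign} {n : ℕ} {m : Fin (n + 2)} (hs : IsSignedHorn s m)
    {j : Fin (n + 2)} {m' : Fin (n + 3)} (hm : IsPullbackIndex m j m') : IsSignedHorn s m' := by
  simp only [IsSignedHorn, IsPullbackIndex, Fin.ext_iff, Fin.lt_def, Fin.val_castSucc,
    Fin.val_succ, Fin.val_zero, Fin.val_last] at hs hm ⊢
  exact ⟨fun h => hs.1 (by omega), fun h => hs.2 (by omega)⟩

/-- A functional signed Kan fibration: a map `α` together with a function choosing a lift for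
every lifting problem of a signed horn inclusion against `α`. -/
structure FunctionalSignedKanFibration (α : X ⟶ Y) where
  /-- The chosen lift, for each of the two signs. -/
  lift : ∀ (s : HornSign) {n : ℕ} (m : Fin (n + 2)) (_ : IsSignedHorn s m)
    (x : (Λ[n + 1, m] : SSet.{w}) ⟶ X) (y : Δ[n + 1] ⟶ Y),
    x ≫ α = Λ[n + 1, m].ι ≫ y → (Δ[n + 1] ⟶ X)
  ι_lift : ∀ (s : HornSign) {n : ℕ} (m : Fin (n + 2)) (hs : IsSignedHorn s m)
    (x : (Λ[n + 1, m] : SSet.{w}) ⟶ X) (y : Δ[n + 1] ⟶ Y)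
    (h : x ≫ α = Λ[n + 1, m].ι ≫ y), Λ[n + 1, m].ι ≫ lift s m hs x y h = x
  lift_comp : ∀ (s : HornSign) {n : ℕ} (m : Fin (n + 2)) (hs : IsSignedHorn s m)
    (x : (Λ[n + 1, m] : SSet.{w}) ⟶ X) (y : Δ[n + 1] ⟶ Y)
    (h : x ≫ α = Λ[n + 1, m].ι ≫ y), lift s m hs x y h ≫ α = y

/-- The condition `lift_±(lift_±(x, y) ∘ s_j ∘ ι*, y ∘ s_j) = lift_±(x, y) ∘ s_j`, for all signed
horn inclusions, all `j` and all `m*`, where `ι*` is the inclusion of the horn `Λ[n + 2, m*]`. -/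
def FunctionalSignedKanFibration.IsEffective {α : X ⟶ Y}
    (F : FunctionalSignedKanFibration α) : Prop :=
  ∀ (s : HornSign) {n : ℕ} (m : Fin (n + 2)) (hs : IsSignedHorn s m)
    (x : (Λ[n + 1, m] : SSet.{w}) ⟶ X) (y : Δ[n + 1] ⟶ Y) (h : x ≫ α = Λ[n + 1, m].ι ≫ y)
    (j : Fin (n + 2)) (m' : Fin (n + 3)) (hm : IsPullbackIndex m j m'),
    F.lift s m' (hs.pullback hm)
      (Λ[n + 2, m'].ι ≫ SSet.stdSimplex.σ j ≫ F.lift s m hs x y h)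
      (SSet.stdSimplex.σ j ≫ y)
      (by simp only [Category.assoc, F.lift_comp]) =
    SSet.stdSimplex.σ j ≫ F.lift s m hs x y h

/-! ## Uniform Kan fibrations -/

/-- The inclusion `{e} × A ⟶ Δ[1] × A` of an end of the cylinder, for the endpoint `e = 0`
(`false`) or `e = 1` (`true`) of `Δ[1]`. -/
noncomputable def cylinderEnd (e : Bool) (A : SSet.{w}) : A ⟶ A ⊗ Δ[1] :=
  match e with
  | false => SSet.ι₀
  | true => SSet.ι₁

/-- A uniform Kan fibration structure on `α : X ⟶ Y`: a choice of lifts against the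
pushout-products `(B × {e}) ∪ (A × Δ[1]) ⟶ B × Δ[1]` of all monomorphisms `i : A ⟶ B` with the
endpoint inclusions `{e} ⟶ Δ[1]`, which is natural with respect to pullback squares between
monomorphisms. A map from the pushout `(B × {e}) ∪ (A × Δ[1])` to `X` is given by its
components `f : B ⟶ X` and `h : A × Δ[1] ⟶ X`, which agree on `A × {e}`. -/
structure UniformKanFibration (α : X ⟶ Y) where
  /-- The chosen lift. -/
  lift : ∀ (e : Bool) {A B : SSet.{w}} (i : A ⟶ B) [Mono i]
    (f : B ⟶ X) (h : A ⊗ Δ[1] ⟶ X) (y : B ⊗ Δ[1] ⟶ Y),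
    i ≫ f = cylinderEnd e A ≫ h → f ≫ α = cylinderEnd e B ≫ y → h ≫ α = i ▷ Δ[1] ≫ y →
    (B ⊗ Δ[1] ⟶ X)
  end_lift : ∀ (e : Bool) {A B : SSet.{w}} (i : A ⟶ B) [Mono i]
    (f : B ⟶ X) (h : A ⊗ Δ[1] ⟶ X) (y : B ⊗ Δ[1] ⟶ Y)
    (h₁ : i ≫ f = cylinderEnd e A ≫ h) (h₂ : f ≫ α = cylinderEnd e B ≫ y)
    (h₃ : h ≫ α = i ▷ Δ[1] ≫ y), cylinderEnd e B ≫ lift e i f h y h₁ h₂ h₃ = f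
  whisker_lift : ∀ (e : Bool) {A B : SSet.{w}} (i : A ⟶ B) [Mono i]
    (f : B ⟶ X) (h : A ⊗ Δ[1] ⟶ X) (y : B ⊗ Δ[1] ⟶ Y)
    (h₁ : i ≫ f = cylinderEnd e A ≫ h) (h₂ : f ≫ α = cylinderEnd e B ≫ y)
    (h₃ : h ≫ α = i ▷ Δ[1] ≫ y), i ▷ Δ[1] ≫ lift e i f h y h₁ h₂ h₃ = h
  lift_comp : ∀ (e : Bool) {A B : SSet.{w}} (i : A ⟶ B) [Mono i]
    (f : B ⟶ X) (h : A ⊗ Δ[1] ⟶ X) (y : B ⊗ Δ[1] ⟶ Y)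
    (h₁ : i ≫ f = cylinderEnd e A ≫ h) (h₂ : f ≫ α = cylinderEnd e B ≫ y)
    (h₃ : h ≫ α = i ▷ Δ[1] ≫ y), lift e i f h y h₁ h₂ h₃ ≫ α = y
  /-- Uniformity: for a pullback square from `i' : A' ⟶ B'` to `i : A ⟶ B`, the chosen lift of
  the restricted lifting problem is the restriction of the chosen lift. (The equations `h₁'`,
  `h₂'`, `h₃'`, saying that the restriction is a lifting problem, follow from `h₁`, `h₂`, `h₃`.) -/
  uniform : ∀ (e : Bool) {A B A' B' : SSet.{w}} (i : A ⟶ B) [Mono i] (i' : A' ⟶ B') [Mono i']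
    (a : A' ⟶ A) (b : B' ⟶ B) (_ : IsPullback a i' i b)
    (f : B ⟶ X) (h : A ⊗ Δ[1] ⟶ X) (y : B ⊗ Δ[1] ⟶ Y)
    (h₁ : i ≫ f = cylinderEnd e A ≫ h) (h₂ : f ≫ α = cylinderEnd e B ≫ y)
    (h₃ : h ≫ α = i ▷ Δ[1] ≫ y)
    (h₁' : i' ≫ b ≫ f = cylinderEnd e A' ≫ a ▷ Δ[1] ≫ h)
    (h₂' : (b ≫ f) ≫ α = cylinderEnd e B' ≫ b ▷ Δ[1] ≫ y)
    (h₃' : (a ▷ Δ[1] ≫ h) ≫ α = i' ▷ Δ[1] ≫ b ▷ Δ[1] ≫ y),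
    lift e i' (b ≫ f) (a ▷ Δ[1] ≫ h) (b ▷ Δ[1] ≫ y) h₁' h₂' h₃' =
      b ▷ Δ[1] ≫ lift e i f h y h₁ h₂ h₃

/-! ## The corresponding notions of Kan complexes

A simplicial set is a Kan complex of some kind if its map to the terminal simplicial set can be
given the structure of a Kan fibration of that kind. -/

/-- `X` is a degenerate-preferring Kan complex. -/
def IsDegeneratePreferringKanComplex (X : SSet.{w}) : Prop :=
  ∃ F : FunctionalKanFibration (terminal.from X), F.IsDegeneratePreferring

/-- `X` is a symmetric effective Kan complex. -/
def IsSymmetricEffectiveKanComplex (X : SSet.{w}) : Prop :=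
  ∃ F : FunctionalKanFibration (terminal.from X), F.IsSymmetricEffective

/-- `X` is an effective Kan complex. -/
def IsEffectiveKanComplex (X : SSet.{w}) : Prop :=
  ∃ F : FunctionalSignedKanFibration (terminal.from X), F.IsEffective

/-- `X` is a uniform Kan complex. -/
def IsUniformKanComplex (X : SSet.{w}) : Prop :=
  Nonempty (UniformKanFibration (terminal.from X))

end KanNotions

/-! A model of a Malcev theory in simplicial sets carries a ternary operation `μ`, compatible with
the faces, with `μ(x, x, y) = y` and `μ(x, y, y) = x`. Horns in it are filled as in simplicial
groups: a wrong face `d_k w` of a candidate `w` is corrected by passing to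
`μ(w, s d_k w, s x_k)`, with a suitable degeneracy `s`, and this does not disturb the faces that
were already right (`SSet.MalcevOperation.exists_correct_face`).

Conversely, in the free simplicial algebra on the horn `Λ[2, 1]` the two generating edges must bound
a triangle. This triangle is a term in the seven `2`-simplices of the horn, and identifying the
variables suitably makes it a Malcev term (`AlgebraicTheory.isMalcev_of_hasTriangles`). Only
triangles on consecutive edges are needed, and uniform lifts provide those directly
(`SSet.hasTriangles_of_isUniformKanComplex`).

It remains to see that every Kan complex has all the additional structures; here the axiom of choice
is used.

* A degenerate filler can be chosen whenever there is one. A degenerate simplex of dimension at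
  least two is determined by all but one of its faces (`SSet.degenerate_eq_of_faces_eq`), so that
  choosing degenerate fillers forces the equations defining symmetric effective and effective Kan
  complexes, whose right hand sides are degenerate.
* For uniform lifts, let `p` be the map from the paths in `X` to `X` that evaluates a path at `0`
  or `1`. As pushout-products of monomorphisms with an endpoint of `Δ[1]` are anodyne, `p` has the
  right lifting property against all monomorphisms. The lifting problems of subcomplexes of standard
  simplices against `p` form a simplicial set, over which those with a solution form another one.
  The projection again has the right lifting property against all monomorphisms
  (`SSet.rlp_solutionsProblem`), hence a section, and a section gives a choice of lifts that is natural
  in pullback squares (`SSet.uniformLift_pullback`). -/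

/-! ### Equational logic and free algebras -/

namespace AlgebraicTheory

open FirstOrder.Language (Term Structure)

theorem term_subst_subst {L : FirstOrder.Language.{u, 0}} {α β γ : Type} (t : L.Term α)
    (f : α → L.Term β) (g : β → L.Term γ) :
    (t.subst f).subst g = t.subst fun a => (f a).subst g := by
  induction t with
  | var a => rfl
  | func F ts ih => exact congrArg (Term.func F) (funext ih)

theorem term_subst_var {L : FirstOrder.Language.{u, 0}} {α : Type} (t : L.Term α) :
    t.subst Term.var = t := by
  induction t with
  | var a => rfl
  | func F ts ih => exact congrArg (Term.func F) (funext ih)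

variable (T : AlgebraicTheory.{u})

variable {T} in
theorem Derivable.subst {α β : Type} {s t : T.language.Term α} (h : T.Derivable s t)
    (g : α → T.language.Term β) : T.Derivable (s.subst g) (t.subst g) := by
  induction h with
  | ax e he f =>
    rw [term_subst_subst, term_subst_subst]
    exact .ax e he _
  | refl t => exact .refl _
  | symm _ ih => exact ih.symm
  | trans _ _ ih₁ ih₂ => exact ih₁.trans ih₂
  | congr F s t _ ih => exact .congr F _ _ ih

variable {T} in
/-- Soundness of equational deduction. -/
theorem Derivable.realize_eq {α : Type} {s t : T.language.Term α} (h : T.Derivable s t)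
    (A : Algebra.{u, w} T) (v : α → A.carrier) : s.realize v = t.realize v := by
  induction h with
  | ax e he f =>
    rw [Term.realize_subst, Term.realize_subst]
    exact A.holds e he _
  | refl t => rfl
  | symm _ ih => exact ih.symm
  | trans _ _ ih₁ ih₂ => exact ih₁.trans ih₂
  | congr F s t _ ih => exact congrArg (Structure.funMap F) (funext ih)

/-- Terms over `α` up to derivable equality. -/
def termSetoid (α : Type) : Setoid (T.language.Term α) where
  r := T.Derivable
  iseqv := ⟨.refl, .symm, .trans⟩

/-- The underlying set of the free algebra on `α`, lifted to the universe of the models. -/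
def FreeCarrier (α : Type) : Type (max u w) :=
  ULift.{w} (Quotient (T.termSetoid α))

variable {α β : Type}

/-- The class of a term in the free algebra. -/
def freeMk (t : T.language.Term α) : FreeCarrier.{u, w} T α := ⟨Quotient.mk _ t⟩

variable {T} in
theorem freeMk_eq_iff {s t : T.language.Term α} :
    freeMk.{u, w} T s = freeMk.{u, w} T t ↔ T.Derivable s t :=
  ULift.up_inj.trans Quotient.eq

theorem freeMk_surjective : Function.Surjective (freeMk.{u, w} T (α := α)) := by
  rintro ⟨x⟩
  obtain ⟨t, rfl⟩ := Quotient.exists_rep x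
  exact ⟨t, rfl⟩

/-- A representing term of an element of the free algebra. -/
noncomputable def freeRep (x : FreeCarrier.{u, w} T α) : T.language.Term α :=
  (freeMk_surjective T x).choose

theorem freeMk_freeRep (x : FreeCarrier.{u, w} T α) : freeMk T (freeRep T x) = x :=
  (freeMk_surjective T x).choose_spec

noncomputable instance (α : Type) : T.language.Structure (FreeCarrier.{u, w} T α) where
  funMap F x := freeMk T (.func F fun i => freeRep T (x i))
  RelMap r _ := (T.isAlgebraic _).elim r

theorem funMap_freeMk {n : ℕ} (F : T.language.Functions n) (t : Fin n → T.language.Term α) :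
    Structure.funMap F (fun i => freeMk.{u, w} T (t i)) = freeMk T (.func F t) :=
  freeMk_eq_iff.2 (.congr F _ _ fun _ => freeMk_eq_iff.1 (freeMk_freeRep.{u, w} T _))

theorem realize_freeMk (t : T.language.Term α) (f : α → T.language.Term β) :
    t.realize (fun a => freeMk.{u, w} T (f a)) = freeMk T (t.subst f) := by
  induction t with
  | var a => rfl
  | func F ts ih =>
    exact (congrArg (Structure.funMap F) (funext ih)).trans (funMap_freeMk T F _)

/-- The free `T`-algebra on a set: terms modulo derivable equality. -/
noncomputable def freeAlgebra (α : Type) : Algebra.{u, max u w} T where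
  carrier := FreeCarrier.{u, w} T α
  holds e he v := by
    have hv : v = fun i => freeMk T (freeRep T (v i)) :=
      funext fun i => (freeMk_freeRep T _).symm
    rw [hv, realize_freeMk, realize_freeMk]
    exact freeMk_eq_iff.2 (.ax e he _)

/-- Renaming of variables, as a map of free algebras. -/
noncomputable def freeRename (g : α → β) (x : FreeCarrier.{u, w} T α) : FreeCarrier.{u, w} T β :=
  freeMk T ((freeRep T x).subst fun a => .var (g a))

theorem freeRename_freeMk (g : α → β) (t : T.language.Term α) :
    freeRename T g (freeMk.{u, w} T t) = freeMk T (t.subst fun a => .var (g a)) :=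
  freeMk_eq_iff.2 ((freeMk_eq_iff.1 (freeMk_freeRep.{u, w} T _)).subst _)

theorem freeRename_comp {γ : Type} (g : α → β) (h : β → γ) (x : FreeCarrier.{u, w} T α) :
    freeRename T h (freeRename T g x) = freeRename T (h ∘ g) x := by
  obtain ⟨t, rfl⟩ := freeMk_surjective T x
  simp only [freeRename_freeMk, term_subst_subst]
  rfl

theorem freeRename_id (x : FreeCarrier.{u, w} T α) : freeRename T id x = x := by
  obtain ⟨t, rfl⟩ := freeMk_surjective T x
  rw [freeRename_freeMk]
  exact congrArg _ (term_subst_var t)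

/-- The free algebra functor. -/
noncomputable def freeFunctor : Type ⥤ Algebra.{u, max u w} T where
  obj α := freeAlgebra.{u, w} T α
  map {α β} g :=
    { toFun := freeRename T g
      map_fun' F x := by
        obtain ⟨t, rfl⟩ : ∃ t : _ → T.language.Term α, x = fun i => freeMk T (t i) :=
          ⟨_, funext fun i => (freeMk_freeRep T (x i)).symm⟩
        have h : (freeRename T g ∘ fun i => freeMk.{u, w} T (t i)) =
            fun i => freeMk T ((t i).subst fun a => .var (g a)) :=
          funext fun i => freeRename_freeMk T g (t i)
        exact ((congrArg _ (funMap_freeMk T F t)).trans (freeRename_freeMk T g _)).trans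
          ((funMap_freeMk T F _).symm.trans (congrArg _ h.symm))
      map_rel' r := (T.isAlgebraic _).elim r }
  map_id α := FirstOrder.Language.Hom.ext fun x => freeRename_id T x
  map_comp g h := FirstOrder.Language.Hom.ext fun x => (freeRename_comp T g h x).symm

/-- The free simplicial algebra on a simplicial set. -/
noncomputable def freeSimplicial (S : SSet.{0}) : SimplicialAlgebra.{u, max u w} T :=
  ((SimplicialObject.whiskering _ _).obj (freeFunctor.{u, w} T)).obj S

end AlgebraicTheory

/-! ### Composing edges in free simplicial algebras -/

namespace SSet

open Simplicial

/-- Any two consecutive edges of `X` are the faces `d₂` and `d₀` of a triangle. -/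
def HasTriangles (X : SSet.{w}) : Prop :=
  ∀ p q : X _⦋1⦌, X.δ 0 p = X.δ 1 q → ∃ t : X _⦋2⦌, X.δ 2 t = p ∧ X.δ 0 t = q

theorem horn₂₁_not_all {s : Δ[2] _⦋2⦌} (hs : s ∈ (horn.{w} 2 1).obj _) :
    ¬ (s 0 = 0 ∧ s 1 = 1 ∧ s 2 = 2) := by
  rintro ⟨h0, h1, h2⟩
  rw [mem_horn_iff_notMem_range] at hs
  obtain ⟨j, _, hj⟩ := hs
  apply hj
  fin_cases j
  exacts [⟨0, h0⟩, ⟨1, h1⟩, ⟨2, h2⟩]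

end SSet

namespace AlgebraicTheory

open Simplicial
open FirstOrder.Language (Term)

variable (T : AlgebraicTheory.{u})

/-- The generator of the free simplicial algebra given by a simplex. -/
def freeVar {S : SSet.{0}} {n : ℕ} (s : S _⦋n⦌) :
    (underlying (freeSimplicial.{u, w} T S)) _⦋n⦌ :=
  freeMk.{u, w} T (.var s)

theorem δ_freeVar {S : SSet.{0}} {n : ℕ} (i : Fin (n + 2)) (s : S _⦋n + 1⦌) :
    (underlying (freeSimplicial.{u, w} T S)).δ i (freeVar T s) = freeVar T (S.δ i s) :=
  freeRename_freeMk T _ _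

variable {T} in
/-- If a term has a generator as its `i`-th face, this equation is derivable after renaming the
variables in any way that factors through the `i`-th face map. -/
theorem derivable_of_δ_eq {S : SSet.{0}} {n : ℕ} {i : Fin (n + 2)}
    {t : T.language.Term (S _⦋n + 1⦌)} {s : S _⦋n⦌}
    (h : (underlying (freeSimplicial.{u, w} T S)).δ i (freeMk.{u, w} T t) = freeVar T s)
    {α : Type} (g : S _⦋n⦌ → α) :
    T.Derivable (t.subst fun x => .var (g (S.δ i x))) (.var (g s)) := by
  have h' : freeMk.{u, w} T (t.subst fun x => .var (S.δ i x)) = freeMk T (.var s) :=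
    (freeRename_freeMk T _ t).symm.trans h
  have := (freeMk_eq_iff.1 h').subst fun x => Term.var (L := T.language) (g x)
  rwa [term_subst_subst] at this

/-- If the two generating edges of the free simplicial algebra on `Λ[2, 1]` bound a triangle `t`,
then `t` is a term in the `2`-simplices of the horn. Renaming `011` to the first variable, `112` to
the third one and all other simplices to the second one turns it into a Malcev operation. -/
theorem isMalcev_of_hasTriangles
    (h : (underlying (freeSimplicial.{u, w} T (Λ[2, 1] : SSet.{0}))).HasTriangles) :
    T.IsMalcev := by
  let p : (Λ[2, 1] : SSet.{0}) _⦋1⦌ := SSet.horn.edge 2 1 0 1 (by decide) (by decide)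
  let q : (Λ[2, 1] : SSet.{0}) _⦋1⦌ := SSet.horn.edge 2 1 1 2 (by decide) (by decide)
  have hpq : (Λ[2, 1] : SSet.{0}).δ 0 p = (Λ[2, 1] : SSet.{0}).δ 1 q := by
    apply Subtype.ext
    apply SSet.stdSimplex.ext
    intro i
    fin_cases i
    rfl
  obtain ⟨t, ht₂, ht₀⟩ := h (freeVar T p) (freeVar T q) (by rw [δ_freeVar, δ_freeVar, hpq])
  obtain ⟨τ, rfl⟩ := freeMk_surjective.{u, w} T t
  let v : (Λ[2, 1] : SSet.{0}) _⦋2⦌ → Fin 3 := fun s =>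
    if s.1 0 = 0 ∧ s.1 1 = 1 then 0 else if s.1 1 = 1 ∧ s.1 2 = 2 then 2 else 1
  refine ⟨τ.subst fun s => .var (v s), ?_, ?_⟩
  · have q0 : q.1 0 = 1 := rfl
    have q1 : q.1 1 = 2 := rfl
    have := derivable_of_δ_eq ht₀ (fun s => if s.1 0 = 1 ∧ s.1 1 = 2 then (1 : Fin 2) else 0)
    rw [q0, q1, if_pos ⟨rfl, rfl⟩] at this
    convert this using 1
    rw [term_subst_subst]
    congr 1
    funext s
    have hs := SSet.horn₂₁_not_all s.2
    have e0 : ((Λ[2, 1] : SSet.{0}).δ 0 s).1 0 = s.1 1 := rfl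
    have e1 : ((Λ[2, 1] : SSet.{0}).δ 0 s).1 1 = s.1 2 := rfl
    simp only [Term.subst, v, e0, e1]
    split_ifs <;> first | rfl | (exfalso; tauto)
  · have p0 : p.1 0 = 0 := rfl
    have p1 : p.1 1 = 1 := rfl
    have := derivable_of_δ_eq ht₂ (fun s => if s.1 0 = 0 ∧ s.1 1 = 1 then (0 : Fin 2) else 1)
    rw [p0, p1, if_pos ⟨rfl, rfl⟩] at this
    convert this using 1
    rw [term_subst_subst]
    congr 1
    funext s
    have e0 : ((Λ[2, 1] : SSet.{0}).δ 2 s).1 0 = s.1 0 := rfl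
    have e1 : ((Λ[2, 1] : SSet.{0}).δ 2 s).1 1 = s.1 1 := rfl
    simp only [Term.subst, v, e0, e1]
    split_ifs <;> rfl

end AlgebraicTheory

namespace SSet

open Simplicial

variable {X : SSet.{w}}

theorem hasTriangles_of_kanComplex [X.KanComplex] : X.HasTriangles := by
  intro p q h
  obtain ⟨φ, hφ⟩ := KanComplex.hornFilling (i := 1)
    (horn₂₁.isPushout.desc (yonedaEquiv.symm p) (yonedaEquiv.symm q) (by
      rw [stdSimplex.δ_comp_yonedaEquiv_symm, stdSimplex.δ_comp_yonedaEquiv_symm, h]))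
  refine ⟨yonedaEquiv φ, ?_, ?_⟩
  · rw [← stdSimplex.yonedaEquiv_δ_comp, ← horn.ι_ι 1 2 (by decide), Category.assoc, ← hφ]
    exact (congrArg yonedaEquiv (horn₂₁.isPushout.inl_desc _ _ _)).trans
      (yonedaEquiv.apply_symm_apply p)
  · rw [← stdSimplex.yonedaEquiv_δ_comp, ← horn.ι_ι 1 0 (by decide), Category.assoc, ← hφ]
    exact (congrArg yonedaEquiv (horn₂₁.isPushout.inr_desc _ _ _)).trans
      (yonedaEquiv.apply_symm_apply q)

open KanNotions CartesianMonoidalCategory SemiCartesianMonoidalCategory in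
/-- Lifting against the pushout-product of `{1} ⟶ Δ[1]` and `{0} ⟶ Δ[1]` gives a square with two
prescribed consecutive sides; one half of it is the required triangle. -/
theorem hasTriangles_of_isUniformKanComplex (hX : IsUniformKanComplex X) : X.HasTriangles := by
  intro p q h
  obtain ⟨F⟩ := hX
  have : Mono (stdSimplex.{w}.δ (0 : Fin 2)) := 
    mono_of_mono_fac (h := 𝟙 _) (CosimplicialObject.δ_comp_σ_self SSet.stdSimplex (i := 0))
  let f : Δ[1] ⟶ X := yonedaEquiv.symm p
  let g : Δ[1] ⟶ X := yonedaEquiv.symm q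
  have h₁ : stdSimplex.δ 0 ≫ f = cylinderEnd false Δ[0] ≫ snd _ _ ≫ g := by
    have : stdSimplex.δ 0 ≫ f = stdSimplex.δ 1 ≫ g := by
      rw [stdSimplex.δ_comp_yonedaEquiv_symm, stdSimplex.δ_comp_yonedaEquiv_symm, h]
    rw [this, stdSimplex.δ_one_eq_const]
    rfl
  let l := F.lift false (stdSimplex.δ (0 : Fin 2)) f (snd _ _ ≫ g) (terminal.from _) h₁
    (Subsingleton.elim _ _) (Subsingleton.elim _ _)
  have hf : cylinderEnd false Δ[1] ≫ l = f := F.end_lift _ _ _ _ _ _ _ _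
  have hg : stdSimplex.δ 0 ▷ _ ≫ l = snd _ _ ≫ g := F.whisker_lift _ _ _ _ _ _ _ _
  refine ⟨yonedaEquiv (lift (stdSimplex.σ 1) (stdSimplex.σ 0) ≫ l), ?_, ?_⟩
  · rw [← stdSimplex.yonedaEquiv_δ_comp, ← (Equiv.eq_symm_apply _)]
    refine Eq.trans ?_ hf
    rw [← Category.assoc]
    congr 1
    ext1
    · have e : stdSimplex.{w}.δ (2 : Fin 3) ≫ stdSimplex.σ 1 = 𝟙 _ :=
        CosimplicialObject.δ_comp_σ_succ stdSimplex (i := 1)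
      rw [Category.assoc, lift_fst, e]
      rfl
    · have e : stdSimplex.{w}.δ (2 : Fin 3) ≫ stdSimplex.σ 0 =
          stdSimplex.σ 0 ≫ stdSimplex.δ 1 :=
        CosimplicialObject.δ_comp_σ_of_gt stdSimplex (i := 1) (j := 0) (by decide)
      rw [Category.assoc, lift_snd, e, stdSimplex.δ_one_eq_const]
      rfl
  · rw [← stdSimplex.yonedaEquiv_δ_comp, ← (Equiv.eq_symm_apply _)]
    have e : stdSimplex.{w}.δ (0 : Fin 3) ≫ stdSimplex.σ 1 =
        stdSimplex.σ 0 ≫ stdSimplex.δ 0 :=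
      CosimplicialObject.δ_comp_σ_of_le stdSimplex (i := 0) (j := 0) (by decide)
    have e' : stdSimplex.{w}.δ (0 : Fin 3) ≫ stdSimplex.σ 0 = 𝟙 _ :=
      CosimplicialObject.δ_comp_σ_self stdSimplex (i := 0)
    have : stdSimplex.{w}.δ (0 : Fin 3) ≫ lift (stdSimplex.σ 1) (stdSimplex.σ 0) =
        lift (stdSimplex.σ 0) (𝟙 _) ≫ stdSimplex.δ 0 ▷ Δ[1] := by
      rw [comp_lift, e, e', lift_whiskerRight]
    rw [← Category.assoc, this, Category.assoc, hg, lift_snd_assoc, Category.id_comp]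

end SSet

/-! ### Malcev operations and horn fillers -/

namespace SSet

open Simplicial

/-- A Malcev operation on the simplices of `X` in each dimension, compatible with the faces. -/
structure MalcevOperation (X : SSet.{w}) where
  /-- The ternary operation. -/
  op : ∀ {n : ℕ}, X _⦋n⦌ → X _⦋n⦌ → X _⦋n⦌ → X _⦋n⦌
  δ_op : ∀ {n : ℕ} (i : Fin (n + 2)) (a b c : X _⦋n + 1⦌),
    X.δ i (op a b c) = op (X.δ i a) (X.δ i b) (X.δ i c)
  op_self_left : ∀ {n : ℕ} (a b : X _⦋n⦌), op a a b = b
  op_self_right : ∀ {n : ℕ} (a b : X _⦋n⦌), op a b b = a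

namespace MalcevOperation

variable {X : SSet.{w}} {n : ℕ} {i : Fin (n + 3)}
  {x : ∀ j : Fin (n + 3), j ≠ i → X _⦋n + 1⦌}

/-- A simplex `w` whose `k`-th face is wrong is replaced by `μ(w, s_c d_k w, s_c x_k)`, where
`d_k s_c = id`. This has the right `k`-th face, and every face `d_j` of `w` with
`j ≠ c, c + 1` that was right remains so, as there `s_c d_k w` and `s_c x_k` agree. -/
theorem exists_correct_face (μ : X.MalcevOperation)
    (hx : ∀ (j k : Fin (n + 3)) (hj : j ≠ i) (hk : k ≠ i) (hjk : j < k),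
      X.δ (k.pred (Fin.ne_zero_of_lt hjk)) (x j hj) =
        X.δ (j.castPred (Fin.ne_last_of_lt hjk)) (x k hk))
    (c : Fin (n + 2)) (k : Fin (n + 3)) (hki : k ≠ i) (hk : k = c.castSucc ∨ k = c.succ)
    (w : X _⦋n + 2⦌) :
    ∃ w' : X _⦋n + 2⦌, X.δ k w' = x k hki ∧
      ∀ (j : Fin (n + 3)) (hj : j ≠ i), j ≠ c.castSucc → j ≠ c.succ →
        X.δ j w = x j hj → X.δ j w' = x j hj := by
  have hσ : ∀ y, X.δ k (X.σ c y) = y := by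
    intro y
    obtain rfl | rfl := hk
    · exact δ_comp_σ_self_apply _ _
    · exact δ_comp_σ_succ_apply _ _
  refine ⟨μ.op w (X.σ c (X.δ k w)) (X.σ c (x k hki)), ?_, ?_⟩
  · rw [μ.δ_op, hσ, hσ, μ.op_self_left]
  · intro j hj hj₁ hj₂ hw
    suffices h : X.δ j (X.σ c (X.δ k w)) = X.δ j (X.σ c (x k hki)) by
      rw [μ.δ_op, h, μ.op_self_right, hw]
    obtain hjc | hjc := lt_or_gt_of_ne hj₁
    · have hjk : j < k := by
        obtain rfl | rfl := hk
        · exact hjc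
        · exact hjc.trans Fin.castSucc_lt_succ
      obtain ⟨j, rfl⟩ := Fin.exists_castSucc_eq.2 (Fin.ne_last_of_lt hjk)
      obtain ⟨k, rfl⟩ := Fin.exists_succ_eq.2 (Fin.ne_zero_of_lt hjk)
      obtain ⟨c, rfl⟩ := Fin.exists_succ_eq.2 (Fin.ne_zero_of_lt (Fin.castSucc_lt_castSucc_iff.1 hjc))
      have hle : j ≤ c.castSucc := by
        simp only [Fin.lt_def, Fin.le_def, Fin.val_castSucc, Fin.val_succ] at hjc ⊢; omega
      have := hx _ _ hj hki hjk
      rw [Fin.pred_succ, Fin.castPred_castSucc] at this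
      rw [δ_comp_σ_of_le_apply hle, δ_comp_σ_of_le_apply hle, ← this, ← hw,
        δ_comp_δ_apply (Fin.castSucc_lt_succ_iff.1 hjk)]
    · have hjc' : c.succ < j :=
        lt_of_le_of_ne (Fin.castSucc_lt_iff_succ_le.1 hjc) (Ne.symm hj₂)
      have hkj : k < j := by
        obtain rfl | rfl := hk
        · exact hjc
        · exact hjc'
      rw [δ_comp_σ_of_gt'_apply hjc', δ_comp_σ_of_gt'_apply hjc']
      congr 1
      have := hx _ _ hki hj hkj
      obtain ⟨k, rfl⟩ := Fin.exists_castSucc_eq.2 (Fin.ne_last_of_lt hkj)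
      obtain ⟨j, rfl⟩ := Fin.exists_succ_eq.2 (Fin.ne_zero_of_lt hkj)
      rw [Fin.pred_succ, Fin.castPred_castSucc] at this
      rw [Fin.pred_succ, this, ← hw, δ_comp_δ_apply (Fin.castSucc_lt_succ_iff.1 hkj)]

/-- The faces below the missing one are corrected in increasing order, then the faces above it in
decreasing order. -/
theorem exists_filler (μ : X.MalcevOperation)
    (hx : ∀ (j k : Fin (n + 3)) (hj : j ≠ i) (hk : k ≠ i) (hjk : j < k),
      X.δ (k.pred (Fin.ne_zero_of_lt hjk)) (x j hj) =
        X.δ (j.castPred (Fin.ne_last_of_lt hjk)) (x k hk)) :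
    ∃ w : X _⦋n + 2⦌, ∀ (j : Fin (n + 3)) (hj : j ≠ i), X.δ j w = x j hj := by
  have below : ∀ t : ℕ, t ≤ i → ∃ w : X _⦋n + 2⦌,
      ∀ (j : Fin (n + 3)) (hj : j ≠ i), (j : ℕ) < t → X.δ j w = x j hj := by
    intro t
    induction t with
    | zero =>
      intro _
      obtain ⟨k, hk⟩ := exists_ne i
      exact ⟨X.σ 0 (x k hk), fun j _ hj => (Nat.not_lt_zero _ hj).elim⟩
    | succ t ih =>
      intro ht
      obtain ⟨w, hw⟩ := ih (by omega)
      have htn : t < n + 2 := by omega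
      have hk : (⟨t, htn⟩ : Fin (n + 2)).castSucc ≠ i := by
        simp only [ne_eq, Fin.ext_iff, Fin.val_castSucc]; omega
      obtain ⟨w', h₁, h₂⟩ := μ.exists_correct_face hx ⟨t, htn⟩ _ hk (.inl rfl) w
      refine ⟨w', fun j hj hjt => ?_⟩
      by_cases hjk : j = (⟨t, htn⟩ : Fin (n + 2)).castSucc
      · subst hjk; exact h₁
      · refine h₂ j hj hjk ?_ (hw j hj ?_) <;>
          simp only [ne_eq, Fin.ext_iff, Fin.val_castSucc, Fin.val_succ] at hjk ⊢ <;> omega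
  have above : ∀ t : ℕ, ∃ w : X _⦋n + 2⦌,
      ∀ (j : Fin (n + 3)) (hj : j ≠ i), j < i ∨ n + 3 ≤ j + t → X.δ j w = x j hj := by
    intro t
    induction t with
    | zero =>
      obtain ⟨w, hw⟩ := below i le_rfl
      exact ⟨w, fun j hj h => hw j hj (h.resolve_right (by omega))⟩
    | succ t ih =>
      obtain ⟨w, hw⟩ := ih
      by_cases ht : i + t < n + 2
      · have hc : n + 1 - t < n + 2 := by omega
        have hk : (⟨n + 1 - t, hc⟩ : Fin (n + 2)).succ ≠ i := by
          simp only [ne_eq, Fin.ext_iff, Fin.val_succ]; omega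
        obtain ⟨w', h₁, h₂⟩ := μ.exists_correct_face hx ⟨n + 1 - t, hc⟩ _ hk (.inr rfl) w
        refine ⟨w', fun j hj hjt => ?_⟩
        by_cases hjk : j = (⟨n + 1 - t, hc⟩ : Fin (n + 2)).succ
        · subst hjk; exact h₁
        · refine h₂ j hj ?_ hjk (hw j hj ?_) <;>
            simp only [ne_eq, Fin.ext_iff, Fin.val_castSucc, Fin.val_succ, Fin.lt_def]
              at hjk hj hjt ⊢ <;> omega
      · refine ⟨w, fun j hj hjt => hw j hj ?_⟩
        simp only [ne_eq, Fin.ext_iff, Fin.lt_def] at hj hjt ⊢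
        omega
  obtain ⟨w, hw⟩ := above (n + 3)
  exact ⟨w, fun j hj => hw j hj (.inr (by omega))⟩

theorem kanComplex (μ : X.MalcevOperation) : X.KanComplex := by
  rw [KanComplex.iff]
  intro n i f hf
  cases n with
  | zero =>
    -- the horn has a single face, which the degeneracy of that vertex extends
    obtain ⟨k, hk⟩ := exists_ne i
    refine ⟨stdSimplex.σ 0 ≫ f k hk, fun j hj => ?_⟩
    obtain rfl : j = k := by omega
    have : stdSimplex.δ j ≫ stdSimplex.σ 0 = 𝟙 (Δ[0] : SSet.{w}) :=
      stdSimplex.isTerminalObj₀.hom_ext _ _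
    rw [← Category.assoc, this, Category.id_comp]
  | succ n =>
    obtain ⟨w, hw⟩ := μ.exists_filler (x := fun j hj => yonedaEquiv (f j hj))
      (fun j k hj hk hjk => by
        rw [← stdSimplex.yonedaEquiv_δ_comp, ← stdSimplex.yonedaEquiv_δ_comp, hf j k hj hk hjk])
    exact ⟨yonedaEquiv.symm w, fun j hj => by
      rw [stdSimplex.δ_comp_yonedaEquiv_symm, hw, Equiv.symm_apply_apply]⟩

end MalcevOperation

end SSet

namespace AlgebraicTheory

open Simplicial
open FirstOrder.Language (Term)

theorem IsMalcev.nonempty_malcevOperation {T : AlgebraicTheory.{u}} (hT : T.IsMalcev)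
    (X : SimplicialAlgebra.{u, w} T) : Nonempty (underlying X).MalcevOperation := by
  obtain ⟨μ, h₁, h₂⟩ := hT
  have key : ∀ (A : Algebra.{u, w} T) (f : Fin 3 → T.language.Term (Fin 2)) (v : Fin 2 → A.carrier)
      (a : Fin 3 → A.carrier), (∀ i, (f i).realize v = a i) → (μ.subst f).realize v = μ.realize a := by
    intro A f v a h
    rw [Term.realize_subst]
    exact congrArg (fun a => μ.realize a) (funext h)
  refine ⟨{
    op := fun {n} a b c =>
      μ.realize (M := (X.obj (Opposite.op ⦋n⦌)).carrier) ![a, b, c]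
    δ_op := fun {n} i a b c => ?_
    op_self_left := fun {n} a b => ?_
    op_self_right := fun {n} a b => ?_ }⟩
  · let φ : T.language.Hom (X.obj (Opposite.op ⦋n + 1⦌)).carrier
        (X.obj (Opposite.op ⦋n⦌)).carrier := X.δ i
    refine (FirstOrder.Language.HomClass.realize_term φ
      (v := (![a, b, c] : Fin 3 → (X.obj (Opposite.op ⦋n + 1⦌)).carrier))).symm.trans ?_
    refine congrArg (fun a => μ.realize a) (funext fun j => ?_)
    fin_cases j <;> rfl
  · have := h₁.realize_eq (X.obj (Opposite.op ⦋n⦌)) ![a, b]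
    rwa [key _ _ _ ![a, a, b] (by intro j; fin_cases j <;> rfl)] at this
  · have := h₂.realize_eq (X.obj (Opposite.op ⦋n⦌)) ![a, b]
    rwa [key _ _ _ ![a, b, b] (by intro j; fin_cases j <;> rfl)] at this

end AlgebraicTheory

/-! ### Degenerate fillers and effective structures -/

namespace SSet

open Simplicial

variable {X : SSet.{w}} {n : ℕ}

theorem σ_injOn_faces {m : Fin (n + 3)} {i : Fin (n + 2)} {a b : X _⦋n + 1⦌}
    (h : ∀ k ≠ m, X.δ k (X.σ i a) = X.δ k (X.σ i b)) : a = b := by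
  by_cases hm : i.castSucc = m
  · have := h i.succ (hm ▸ Fin.castSucc_lt_succ.ne')
    rwa [δ_comp_σ_succ_apply, δ_comp_σ_succ_apply] at this
  · have := h i.castSucc hm
    rwa [δ_comp_σ_self_apply, δ_comp_σ_self_apply] at this

theorem degenerate_eq_of_faces_eq_of_lt {m : Fin (n + 3)} {i j : Fin (n + 2)} (hij : i < j)
    {a b : X _⦋n + 1⦌} (h : ∀ k ≠ m, X.δ k (X.σ i a) = X.δ k (X.σ j b)) :
    X.σ i a = X.σ j b := by
  obtain ⟨j, rfl⟩ := Fin.exists_succ_eq.2 (Fin.ne_zero_of_lt hij)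
  obtain ⟨i, rfl⟩ := Fin.exists_castSucc_eq.2 (Fin.ne_last_of_lt hij)
  have hij' : i ≤ j := Fin.castSucc_lt_succ_iff.1 hij
  -- it suffices that `b` is `s_i`-degenerate, since then so is `s_j b`
  suffices hb : ∃ c, b = X.σ i c by
    obtain ⟨c, rfl⟩ := hb
    have e : X.σ j.succ (X.σ i c) = X.σ i.castSucc (X.σ j c) := (σ_comp_σ_apply hij' c).symm
    rw [e] at h ⊢
    rw [σ_injOn_faces h]
  have gt : ∀ k : Fin (n + 3), i.castSucc.succ < k → ∃ c, X.δ k (X.σ i.castSucc a) = X.σ i c :=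
    fun k hk => ⟨_, δ_comp_σ_of_gt'_apply hk a⟩
  by_cases hm : j.succ.succ = m
  · have hm' : j.succ.castSucc ≠ m := hm ▸ Fin.castSucc_lt_succ.ne
    have hb := h _ hm'
    rw [δ_comp_σ_self_apply] at hb
    obtain rfl | hlt := hij'.eq_or_lt
    · have e : i.succ.castSucc = i.castSucc.succ := rfl
      rw [e, δ_comp_σ_succ_apply] at hb
      subst hb
      have hi := h i.castSucc.castSucc (by
        rw [← hm]; simp only [ne_eq, Fin.ext_iff, Fin.val_castSucc, Fin.val_succ]; omega)
      rw [δ_comp_σ_self_apply, δ_comp_σ_of_le_apply le_rfl] at hi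
      exact ⟨_, hi⟩
    · obtain ⟨c, hc⟩ := gt j.succ.castSucc (by
        simp only [Fin.lt_def, Fin.val_castSucc, Fin.val_succ] at hlt ⊢; omega)
      exact ⟨c, hb.symm.trans hc⟩
  · have hb := h _ hm
    rw [δ_comp_σ_succ_apply] at hb
    obtain ⟨c, hc⟩ := gt j.succ.succ (by
      simp only [Fin.le_def, Fin.lt_def, Fin.val_castSucc, Fin.val_succ] at hij' ⊢; omega)
    exact ⟨c, hb.symm.trans hc⟩

/-- A degenerate simplex of dimension at least two is determined by all but one of its faces. -/
theorem degenerate_eq_of_faces_eq {m : Fin (n + 3)} {i j : Fin (n + 2)}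
    {a b : X _⦋n + 1⦌} (h : ∀ k ≠ m, X.δ k (X.σ i a) = X.δ k (X.σ j b)) :
    X.σ i a = X.σ j b := by
  obtain hij | rfl | hij := lt_trichotomy i j
  · exact degenerate_eq_of_faces_eq_of_lt hij h
  · rw [σ_injOn_faces h]
  · exact (degenerate_eq_of_faces_eq_of_lt hij fun k hk => (h k hk).symm).symm

/-- A horn of dimension at least two has at most one degenerate filler. -/
theorem horn_degenerate_filler_unique {m : Fin (n + 3)} {i j : Fin (n + 2)}
    {a b : Δ[n + 1] ⟶ X}
    (h : Λ[n + 2, m].ι ≫ stdSimplex.σ i ≫ a = Λ[n + 2, m].ι ≫ stdSimplex.σ j ≫ b) :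
    stdSimplex.σ i ≫ a = stdSimplex.σ j ≫ b := by
  apply yonedaEquiv.injective
  rw [stdSimplex.yonedaEquiv_σ_comp, stdSimplex.yonedaEquiv_σ_comp]
  refine degenerate_eq_of_faces_eq (m := m) fun k hk => ?_
  rw [← stdSimplex.yonedaEquiv_σ_comp, ← stdSimplex.yonedaEquiv_σ_comp,
    ← stdSimplex.yonedaEquiv_δ_comp, ← stdSimplex.yonedaEquiv_δ_comp,
    ← horn.ι_ι m k hk, Category.assoc, Category.assoc, h]

theorem kanComplex_of_hornFilling
    (h : ∀ {n : ℕ} (m : Fin (n + 2)) (x : (Λ[n + 1, m] : SSet.{w}) ⟶ X),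
      ∃ l, Λ[n + 1, m].ι ≫ l = x) : X.KanComplex := by
  rw [KanComplex.iff]
  intro n i f hf
  obtain ⟨l, hl⟩ := h i hf.desc
  exact ⟨l, fun j hj => by rw [← horn.ι_ι i j hj, Category.assoc, hl, horn.IsCompatible.ι_desc]⟩

end SSet

namespace KanNotions

open Simplicial

variable {X Y : SSet.{w}}

theorem FunctionalKanFibration.kanComplex (F : FunctionalKanFibration (terminal.from X)) :
    X.KanComplex :=
  SSet.kanComplex_of_hornFilling fun m x =>
    ⟨_, F.ι_lift m x (terminal.from _) (Subsingleton.elim _ _)⟩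

theorem FunctionalSignedKanFibration.kanComplex
    (F : FunctionalSignedKanFibration (terminal.from X)) : X.KanComplex :=
  SSet.kanComplex_of_hornFilling fun {n} m x => by
    by_cases hm : m = 0
    · subst hm
      exact ⟨_, F.ι_lift .minus 0 ⟨fun _ => rfl, fun h => (Fin.last_pos.ne h).elim⟩ x
        (terminal.from _) (Subsingleton.elim _ _)⟩
    · exact ⟨_, F.ι_lift .plus m ⟨fun h => (hm h).elim, fun _ => rfl⟩ x
        (terminal.from _) (Subsingleton.elim _ _)⟩

open scoped Classical in
/-- Choose a degenerate filler whenever there is one. -/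
theorem isDegeneratePreferringKanComplex [X.KanComplex] :
    IsDegeneratePreferringKanComplex X := by
  have key : ∀ {n : ℕ} (m : Fin (n + 2)) (x : (Λ[n + 1, m] : SSet.{w}) ⟶ X),
      ∃ l : Δ[n + 1] ⟶ X, Λ[n + 1, m].ι ≫ l = x ∧
        ((∃ (j : Fin (n + 1)) (z : Δ[n] ⟶ X), Λ[n + 1, m].ι ≫ SSet.stdSimplex.σ j ≫ z = x) →
          ∃ (j : Fin (n + 1)) (z : Δ[n] ⟶ X), l = SSet.stdSimplex.σ j ≫ z) := by
    intro n m x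
    by_cases h : ∃ (j : Fin (n + 1)) (z : Δ[n] ⟶ X),
        Λ[n + 1, m].ι ≫ SSet.stdSimplex.σ j ≫ z = x
    · obtain ⟨j, z, hz⟩ := h
      exact ⟨_, hz, fun _ => ⟨j, z, rfl⟩⟩
    · obtain ⟨l, hl⟩ := SSet.KanComplex.hornFilling x
      exact ⟨l, hl.symm, fun h' => (h h').elim⟩
  choose l hl hd using @key
  exact ⟨{ lift := fun m x _ _ => l m x
           ι_lift := fun m x _ _ => hl m x
           lift_comp := fun _ _ _ _ => Subsingleton.elim _ _ },
    fun m x _ _ ⟨j, z, hz, _⟩ => hd m x ⟨j, z, hz⟩⟩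

/-- By uniqueness of degenerate fillers, a degenerate solution is the chosen one. -/
theorem FunctionalKanFibration.IsDegeneratePreferring.lift_eq {α : X ⟶ Y}
    {F : FunctionalKanFibration α} (hF : F.IsDegeneratePreferring) {n : ℕ} {m : Fin (n + 3)}
    {x : (Λ[n + 2, m] : SSet.{w}) ⟶ X} {y : Δ[n + 2] ⟶ Y} (h : x ≫ α = Λ[n + 2, m].ι ≫ y)
    {j : Fin (n + 2)} {z : Δ[n + 1] ⟶ X} (hx : Λ[n + 2, m].ι ≫ SSet.stdSimplex.σ j ≫ z = x)
    (hy : (SSet.stdSimplex.σ j ≫ z) ≫ α = y) :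
    F.lift m x y h = SSet.stdSimplex.σ j ≫ z := by
  obtain ⟨i, a, ha⟩ := hF m x y h ⟨j, z, hx, hy⟩
  rw [ha]
  refine SSet.horn_degenerate_filler_unique (m := m) ?_
  rw [← ha, F.ι_lift, hx]

theorem FunctionalKanFibration.IsDegeneratePreferring.isSymmetricEffective {α : X ⟶ Y}
    {F : FunctionalKanFibration α} (hF : F.IsDegeneratePreferring) : F.IsSymmetricEffective := by
  intro n m x y h j m' hm x' hx'
  refine hF.lift_eq _ ?_ ?_
  · exact ((isPulledBackHorn_iff (F.ι_lift m x y h) hm x').1 hx').symm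
  · rw [Category.assoc, F.lift_comp]

/-- The lifts of a functional Kan fibration, used for both signs. -/
def FunctionalKanFibration.toSigned {α : X ⟶ Y} (F : FunctionalKanFibration α) :
    FunctionalSignedKanFibration α where
  lift _ _ m _ := F.lift m
  ι_lift _ _ m _ := F.ι_lift m
  lift_comp _ _ m _ := F.lift_comp m

theorem FunctionalKanFibration.IsDegeneratePreferring.isEffective_toSigned {α : X ⟶ Y}
    {F : FunctionalKanFibration α} (hF : F.IsDegeneratePreferring) : F.toSigned.IsEffective := by
  intro s n m hs x y h j m' hm
  refine hF.lift_eq _ rfl ?_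
  rw [Category.assoc]
  exact congrArg _ (F.lift_comp m x y h)

end KanNotions

/-! ### Uniform choices of lifts against monomorphisms -/

namespace SSet

open Simplicial Opposite

variable {P X : SSet.{w}} (p : P ⟶ X)

/-- A lifting problem against `p` whose codomain is the standard simplex `n` and whose domain is a
subcomplex of it: a simplex `base` of `X` and a partial lift of it to `P`. The value of the partial
lift at a simplex `φ` is `none` when `φ` does not belong to the subcomplex. -/
@[ext]
structure SimplexProblem (n : SimplexCategoryᵒᵖ) where
  /-- The simplex to be lifted. -/
  base : X.obj n
  /-- The partial lift. -/
  part : ∀ d : SimplexCategory, (d ⟶ n.unop) → Option (P.obj (op d))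
  natural : ∀ {d d' : SimplexCategory} (ψ : d' ⟶ d) (φ : d ⟶ n.unop) (k : P.obj (op d)),
    part d φ = some k → part d' (ψ ≫ φ) = some (P.map ψ.op k)
  map_eq : ∀ {d : SimplexCategory} (φ : d ⟶ n.unop) (k : P.obj (op d)),
    part d φ = some k → p.app (op d) k = X.map φ.op base

/-- Restriction of a lifting problem along a map of simplices. -/
def SimplexProblem.restrict {m n : SimplexCategoryᵒᵖ} (θ : m ⟶ n) (D : SimplexProblem p m) :
    SimplexProblem p n where
  base := X.map θ D.base
  part d φ := D.part d (φ ≫ θ.unop)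
  natural ψ φ k h := by
    rw [Category.assoc]
    exact D.natural ψ _ k h
  map_eq φ k h := by
    rw [D.map_eq _ k h, ← Functor.map_comp_apply]
    rfl

/-- A total lift extending the partial one. -/
def SimplexProblem.IsSolution {n : SimplexCategoryᵒᵖ} (D : SimplexProblem p n) (k : P.obj n) :
    Prop :=
  p.app n k = D.base ∧
    ∀ {d : SimplexCategory} (φ : d ⟶ n.unop) (k' : P.obj (op d)),
      D.part d φ = some k' → k' = P.map φ.op k

/-- The simplicial set of lifting problems against `p`. -/
def problems : SSet.{w} where
  obj n := SimplexProblem p n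
  map θ := ↾ SimplexProblem.restrict p θ
  map_id n := by
    refine ConcreteCategory.hom_ext _ _ fun D => ?_
    refine SimplexProblem.ext ?_ ?_
    · exact X.map_id_apply _ _
    · funext d φ
      exact congrArg (D.part d) (Category.comp_id φ)
  map_comp θ θ' := by
    refine ConcreteCategory.hom_ext _ _ fun D => ?_
    refine SimplexProblem.ext ?_ ?_
    · exact X.map_comp_apply _ _ _
    · funext d φ
      exact congrArg (D.part d) (Category.assoc _ _ _).symm

/-- The simplicial set of lifting problems against `p` with a solution. -/
def solutions : SSet.{w} where
  obj n := { s : SimplexProblem p n × P.obj n // s.1.IsSolution p s.2 }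
  map θ := ↾ fun s => ⟨(s.1.1.restrict p θ, P.map θ s.1.2), by
    refine ⟨?_, fun φ k' h => ?_⟩
    · exact (NatTrans.naturality_apply p θ _).trans (congrArg (X.map θ) s.2.1)
    · rw [s.2.2 _ k' h, ← Functor.map_comp_apply]
      rfl⟩
  map_id n := by
    refine ConcreteCategory.hom_ext _ _ fun s => ?_
    exact Subtype.ext (Prod.ext ((problems p).map_id_apply _ _) (P.map_id_apply _ _))
  map_comp θ θ' := by
    refine ConcreteCategory.hom_ext _ _ fun s => ?_
    exact Subtype.ext (Prod.ext ((problems p).map_comp_apply _ _ _) (P.map_comp_apply _ _ _))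

/-- Forgetting the solution. -/
def solutionsProblem : solutions p ⟶ problems p where
  app n := ↾ fun s => s.1.1

/-- The solution, as a simplex of `P`. -/
def solutionsLift : solutions p ⟶ P where
  app n := ↾ fun s => s.1.2

/-- A solution given on the boundary of a simplex extends: if the problem is to extend a total lift,
that lift is the solution; otherwise the problem lives on the boundary, so that any lift extending
the given one is a solution. -/
theorem rlp_solutionsProblem (hp : (MorphismProperty.monomorphisms SSet.{w}).rlp p) :
    (MorphismProperty.monomorphisms SSet.{w}).rlp (solutionsProblem p) := by
  rw [rlp_monomorphisms]
  rintro _ _ _ ⟨n⟩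
  refine ⟨fun {t b} sq => ?_⟩
  let D : SimplexProblem p (op ⦋n⦌) := yonedaEquiv b
  have hb : ∀ {d : SimplexCategoryᵒᵖ} (s : Δ[n].obj d),
      b.app d s = D.restrict p (stdSimplex.objEquiv s).op := fun {d} s => by
    conv_lhs => rw [← yonedaEquiv.symm_apply_apply b]
    rfl
  have ht : ∀ {d : SimplexCategoryᵒᵖ} (s : (∂Δ[n] : SSet.{w}).obj d),
      (t.app d s).1.1 = D.restrict p (stdSimplex.objEquiv s.1).op := fun {d} s => by
    have h := ConcreteCategory.congr_hom (NatTrans.congr_app sq.w d) s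
    exact h.trans (hb s.1)
  have hsol : ∀ {d : SimplexCategoryᵒᵖ} (s : (∂Δ[n] : SSet.{w}).obj d) (k : P.obj d),
      D.part d.unop (stdSimplex.objEquiv s.1) = some k → k = (t.app d s).1.2 := fun {d} s k hs => by
    refine ((t.app d s).2.2 (𝟙 _) k ?_).trans (P.map_id_apply _ _)
    rw [ht]
    exact (congrArg (D.part _) (Category.id_comp _)).trans hs
  suffices hk : ∃ k : P.obj (op ⦋n⦌), D.IsSolution p k ∧
      ∀ {d : SimplexCategoryᵒᵖ} (s : (∂Δ[n] : SSet.{w}).obj d),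
        (t.app d s).1.2 = P.map (stdSimplex.objEquiv s.1).op k by
    obtain ⟨k, hk, hkt⟩ := hk
    let S : (solutions p).obj (op ⦋n⦌) := ⟨(D, k), hk⟩
    refine ⟨⟨⟨yonedaEquiv.symm S, ?_, ?_⟩⟩⟩
    · ext d s
      exact Subtype.ext (Prod.ext (ht s).symm (hkt s).symm)
    · rw [yonedaEquiv_symm_comp, Equiv.symm_apply_eq]
      rfl
  cases hD : D.part ⦋n⦌ (𝟙 _) with
  | some k =>
    have hpart : ∀ {d : SimplexCategory} (φ : d ⟶ ⦋n⦌), D.part d φ = some (P.map φ.op k) := by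
      intro d φ
      have := D.natural φ (𝟙 _) k hD
      rwa [Category.comp_id] at this
    -- the partial lift is total, with value `k` at the top simplex
    refine ⟨k, ⟨?_, fun φ k' h => ?_⟩, fun {d} s => ?_⟩
    · exact (D.map_eq (𝟙 _) k hD).trans (Functor.map_id_apply _ _ _)
    · rw [hpart] at h
      exact (Option.some.inj h).symm
    · exact (hsol s _ (hpart _)).symm
  | none =>
    have sq' : CommSq (t ≫ solutionsLift p) ∂Δ[n].ι p (yonedaEquiv.symm D.base) := ⟨by
      ext d s
      exact (t.app d s).2.1.trans (congrArg SimplexProblem.base (ht s))⟩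
    have := hp ∂Δ[n].ι inferInstance
    have hl : ∀ {d : SimplexCategoryᵒᵖ} (s : (∂Δ[n] : SSet.{w}).obj d),
        (t.app d s).1.2 = P.map (stdSimplex.objEquiv s.1).op (yonedaEquiv sq'.lift) :=
      fun {d} s => by
        have h := ConcreteCategory.congr_hom (NatTrans.congr_app sq'.fac_left d) s
        refine h.symm.trans ?_
        conv_lhs => rw [← yonedaEquiv.symm_apply_apply sq'.lift]
        rfl
    refine ⟨yonedaEquiv sq'.lift, ⟨?_, fun {d} φ k' h => ?_⟩, hl⟩
    · have h := congrArg yonedaEquiv sq'.fac_right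
      rw [Equiv.apply_symm_apply] at h
      exact h
    · -- as the partial lift is not total, it is defined on simplices of the boundary only
      have hφ : stdSimplex.objEquiv.symm φ ∈ (boundary.{w} n).obj (op d) := by
        intro hs
        have : Epi φ := SimplexCategory.epi_iff_surjective.2 hs
        have := isSplitEpi_of_epi φ
        have h' := D.natural (section_ φ) φ k' h
        rw [IsSplitEpi.id, hD] at h'
        cases h'
      exact (hsol ⟨_, hφ⟩ k' h).trans (hl ⟨_, hφ⟩)

section uniform

variable {p} {A B : SSet.{w}} (i : A ⟶ B) [Mono i] (g : A ⟶ P) (f : B ⟶ X)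

open scoped Classical in
/-- The map `g`, seen as a partial map on the codomain of the monomorphism `i`. -/
noncomputable def partialMap (d : SimplexCategoryᵒᵖ) (b : B.obj d) : Option (P.obj d) :=
  if h : ∃ a, i.app d a = b then some (g.app d h.choose) else none

theorem partialMap_app (d : SimplexCategoryᵒᵖ) (a : A.obj d) :
    partialMap i g d (i.app d a) = some (g.app d a) := by
  have h : ∃ a', i.app d a' = i.app d a := ⟨a, rfl⟩
  have hi : Function.Injective (i.app d) := (mono_iff_injective _).1 inferInstance
  rw [partialMap, dif_pos h, hi h.choose_spec]

theorem partialMap_eq_some_iff (d : SimplexCategoryᵒᵖ) (b : B.obj d) (k : P.obj d) :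
    partialMap i g d b = some k ↔ ∃ a, i.app d a = b ∧ g.app d a = k := by
  constructor
  · intro h
    by_cases hb : ∃ a, i.app d a = b
    · obtain ⟨a, rfl⟩ := hb
      rw [partialMap_app] at h
      exact ⟨a, rfl, Option.some.inj h⟩
    · rw [partialMap, dif_neg hb] at h
      cases h
  · rintro ⟨a, rfl, rfl⟩
    exact partialMap_app i g d a

/-- A lifting problem of a monomorphism `i` against `p` restricts to one on each simplex of the
codomain of `i`; this is the corresponding map to the simplicial set of lifting problems. -/
noncomputable def problemMap (h : g ≫ p = i ≫ f) : B ⟶ problems p where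
  app n := ↾ fun b =>
    { base := f.app n b
      part := fun d φ => partialMap i g (op d) (B.map φ.op b)
      natural := fun {d d'} ψ φ k hk => by
        rw [partialMap_eq_some_iff] at hk ⊢
        obtain ⟨a, ha, rfl⟩ := hk
        refine ⟨A.map ψ.op a, ?_, NatTrans.naturality_apply g _ _⟩
        rw [NatTrans.naturality_apply, ha, ← Functor.map_comp_apply]
        rfl
      map_eq := fun {d} φ k hk => by
        rw [partialMap_eq_some_iff] at hk
        obtain ⟨a, ha, rfl⟩ := hk
        rw [← NatTrans.naturality_apply, ← ha]
        exact ConcreteCategory.congr_hom (NatTrans.congr_app h (op d)) a }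
  naturality m n θ := by
    refine ConcreteCategory.hom_ext _ _ fun b => SimplexProblem.ext ?_ ?_
    · exact NatTrans.naturality_apply f θ b
    · funext d φ
      exact congrArg (partialMap i g (op d)) (B.map_comp_apply θ φ.op b).symm

theorem exists_section_solutionsProblem (hp : (MorphismProperty.monomorphisms SSet.{w}).rlp p) :
    ∃ s : problems p ⟶ solutions p, s ≫ solutionsProblem p = 𝟙 _ := by
  have sq : CommSq (initial.to (solutions p)) (initial.to (problems p)) (solutionsProblem p)
    (𝟙 _) := ⟨initial.hom_ext _ _⟩
  have := rlp_solutionsProblem p hp (initial.to (problems p))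
    (MorphismProperty.monomorphisms.infer_property _)
  exact ⟨sq.lift, sq.fac_right⟩

variable (p) in
/-- A section of the simplicial set of solutions over that of lifting problems. -/
noncomputable def chosenSolution (hp : (MorphismProperty.monomorphisms SSet.{w}).rlp p) :
    problems p ⟶ solutions p :=
  (exists_section_solutionsProblem hp).choose

theorem chosenSolution_isSolution (hp : (MorphismProperty.monomorphisms SSet.{w}).rlp p)
    {n : SimplexCategoryᵒᵖ} (D : SimplexProblem p n) :
    D.IsSolution p ((chosenSolution p hp ≫ solutionsLift p).app n D) := by
  have h : (((chosenSolution p hp).app n D).1.1 : SimplexProblem p n) = D := by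
    have e := NatTrans.congr_app (exists_section_solutionsProblem hp).choose_spec n
    exact ConcreteCategory.congr_hom e D
  have := ((chosenSolution p hp).app n D).2
  rw [h] at this
  exact this

/-- The lifts against `p` given by a fixed section of the solutions over the lifting problems. -/
noncomputable def uniformLift (hp : (MorphismProperty.monomorphisms SSet.{w}).rlp p)
    (h : g ≫ p = i ≫ f) : B ⟶ P :=
  problemMap i g f h ≫ chosenSolution p hp ≫ solutionsLift p

variable (hp : (MorphismProperty.monomorphisms SSet.{w}).rlp p)

theorem uniformLift_comp (h : g ≫ p = i ≫ f) : uniformLift i g f hp h ≫ p = f := by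
  ext n b
  exact (chosenSolution_isSolution hp ((problemMap i g f h).app n b)).1

theorem comp_uniformLift (h : g ≫ p = i ≫ f) : i ≫ uniformLift i g f hp h = g := by
  ext n a
  have hs := (chosenSolution_isSolution hp ((problemMap i g f h).app n (i.app n a))).2
    (𝟙 n.unop) (g.app n a)
    ((congrArg (partialMap i g n) (B.map_id_apply _ _)).trans (partialMap_app i g n a))
  exact (hs.trans (P.map_id_apply _ _)).symm

/-- Uniformity: for a pullback square, the lifting problems induced on the simplices of `B'` are
those induced on their images in `B`. -/
theorem uniformLift_pullback (h : g ≫ p = i ≫ f) {A' B' : SSet.{w}} (i' : A' ⟶ B') [Mono i']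
    {a : A' ⟶ A} {b : B' ⟶ B} (sq : IsPullback a i' i b)
    (h' : (a ≫ g) ≫ p = i' ≫ b ≫ f) :
    uniformLift i' (a ≫ g) (b ≫ f) hp h' = b ≫ uniformLift i g f hp h := by
  have key : problemMap i' (a ≫ g) (b ≫ f) h' = b ≫ problemMap i g f h := by
    refine NatTrans.ext (funext fun n => ConcreteCategory.hom_ext _ _ fun x => ?_)
    refine SimplexProblem.ext rfl ?_
    funext d φ
    refine Option.ext fun k => ?_
    have hb := NatTrans.naturality_apply b φ.op x
    refine (partialMap_eq_some_iff i' (a ≫ g) _ _ _).trans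
      (Iff.trans ?_ (partialMap_eq_some_iff i g _ _ _).symm)
    constructor
    · rintro ⟨a', ha', rfl⟩
      refine ⟨a.app _ a', ?_, rfl⟩
      refine Eq.trans (ConcreteCategory.congr_hom (NatTrans.congr_app sq.w (op d)) a') ?_
      exact (congrArg (b.app (op d)) ha').trans hb
    · rintro ⟨a₀, ha₀, rfl⟩
      have sqd := sq.map ((evaluation _ _).obj (op d))
      obtain ⟨a', h₁, h₂⟩ := Types.exists_of_isPullback sqd a₀ (B'.map φ.op x) (ha₀.trans hb.symm)
      exact ⟨a', h₂, congrArg (g.app (op d)) h₁⟩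
  rw [uniformLift, key, uniformLift, Category.assoc]

end uniform

end SSet

/-! ### Kan complexes are uniform Kan complexes -/

namespace KanNotions

open Simplicial Opposite CartesianMonoidalCategory SemiCartesianMonoidalCategory

variable {X : SSet.{w}}

/-- The vertex of `Δ[1]` at which a cylinder end is located. -/
def endVertex (e : Bool) : Fin 2 :=
  match e with
  | false => 0
  | true => 1

theorem cylinderEnd_eq (e : Bool) (A : SSet.{w}) :
    cylinderEnd e A = lift (𝟙 A) (SSet.const (SSet.stdSimplex.obj₀Equiv.symm (endVertex e))) := by
  cases e <;> rfl

theorem cylinderEnd_whiskerRight (e : Bool) {A B : SSet.{w}} (f : A ⟶ B) :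
    cylinderEnd e A ≫ f ▷ Δ[1] = f ≫ cylinderEnd e B := by
  cases e <;> rfl

/-- A horn of dimension one is the vertex it is named after. -/
theorem horn_one_ι (v : Fin 2) :
    Λ[1, v].ι = SSet.const (X := (Λ[1, v] : SSet.{w})) (SSet.stdSimplex.obj₀Equiv.symm v) := by
  refine NatTrans.ext (funext fun ⟨⟨d⟩⟩ => ConcreteCategory.hom_ext _ _ fun s => ?_)
  refine SSet.stdSimplex.ext _ _ fun k => ?_
  obtain ⟨j, hj, hs⟩ := (SSet.mem_horn_iff_notMem_range _ _).1 s.2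
  have : (s.1 : Δ[1] _⦋d⦌) k ≠ j := fun h => hs ⟨k, h⟩
  change (s.1 : Δ[1] _⦋d⦌) k = v
  omega

theorem vertex_mem_horn_one (v : Fin 2) :
    SSet.stdSimplex.obj₀Equiv.symm v ∈ (SSet.horn.{w} 1 v).obj (op ⦋0⦌) := by
  rw [SSet.mem_horn_iff_notMem_range]
  obtain ⟨j, hj⟩ := exists_ne v
  exact ⟨j, hj, fun ⟨k, hk⟩ => hj hk.symm⟩

open SSet.modelCategoryQuillen in
/-- The homotopy extension property of Kan complexes: the pushout-product of a monomorphism with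
an endpoint of `Δ[1]`, that is with the inclusion of a horn of dimension one, is anodyne. -/
theorem exists_cylinder_extension [X.KanComplex] (e : Bool) {A B : SSet.{w}} (i : A ⟶ B) [Mono i]
    (f : B ⟶ X) (h : A ⊗ Δ[1] ⟶ X) (hfh : i ≫ f = cylinderEnd e A ≫ h) :
    ∃ l : B ⊗ Δ[1] ⟶ X, cylinderEnd e B ≫ l = f ∧ i ▷ Δ[1] ≫ l = h := by
  let v := endVertex e
  let j : (Λ[1, v] : SSet.{w}) ⟶ Δ[1] := Λ[1, v].ι
  let sq := Functor.PushoutObjObj.ofHasPushout (curriedTensor SSet.{w}) i j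
  have hw : A ◁ j = fst _ _ ≫ cylinderEnd e A := by
    rw [cylinderEnd_eq]
    ext1
    · simp
    · simp [j, horn_one_ι, v]
  have comm : i ▷ _ ≫ (fst _ _ ≫ f) = A ◁ j ≫ h := by
    rw [hw, Category.assoc, ← hfh, whiskerRight_fst_assoc]
  have han : SSet.anodyneExtensions sq.ι :=
    SSet.anodyneExtensions_pushoutObjObjι sq (SSet.anodyneExtensions.horn_ι v)
  have := han (terminal.from X) (HomotopicalAlgebra.mem_fibrations _)
  have sq' : CommSq (sq.isPushout.desc (fst _ _ ≫ f) h comm) sq.ι (terminal.from X)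
    (terminal.from _) := ⟨Subsingleton.elim _ _⟩
  refine ⟨sq'.lift, ?_, ?_⟩
  · have hB : cylinderEnd e B =
        lift (𝟙 B) (SSet.const (X := B) (Y := (Λ[1, v] : SSet.{w})) ⟨_, vertex_mem_horn_one v⟩) ≫
          B ◁ j := by
      rw [cylinderEnd_eq, lift_whiskerLeft]
      rfl
    have hl : B ◁ j ≫ sq'.lift = fst _ _ ≫ f := by
      have := sq.inl ≫= sq'.fac_left
      rw [← Category.assoc, sq.inl_ι, sq.isPushout.inl_desc] at this
      exact this
    rw [hB, Category.assoc, hl, lift_fst_assoc, Category.id_comp]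
  · have := sq.inr ≫= sq'.fac_left
    rw [← Category.assoc, sq.inr_ι, sq.isPushout.inr_desc] at this
    exact this

variable (X) in
/-- The simplicial set of paths in `X`. -/
noncomputable abbrev pathSpace : SSet.{w} := (ihom (Δ[1] : SSet.{w})).obj X

variable (X) in
/-- Evaluation of a path at a point of `Δ[1]`. -/
noncomputable def pathEval : pathSpace X ⊗ Δ[1] ⟶ X :=
  (β_ _ _).hom ≫ (ihom.ev Δ[1]).app X

/-- The family of paths given by a homotopy. -/
noncomputable def toPath {A : SSet.{w}} (h : A ⊗ Δ[1] ⟶ X) : A ⟶ pathSpace X :=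
  MonoidalClosed.curry ((β_ _ _).hom ≫ h)

theorem toPath_whiskerRight {A : SSet.{w}} (h : A ⊗ Δ[1] ⟶ X) :
    toPath h ▷ Δ[1] ≫ pathEval X = h := by
  rw [pathEval, BraidedCategory.braiding_naturality_left_assoc, toPath,
    ← MonoidalClosed.uncurry_eq, MonoidalClosed.uncurry_curry]
  simp

theorem toPath_unique {A : SSet.{w}} {g g' : A ⟶ pathSpace X}
    (h : g ▷ Δ[1] ≫ pathEval X = g' ▷ Δ[1] ≫ pathEval X) : g = g' := by
  apply MonoidalClosed.uncurry_injective
  rw [pathEval, BraidedCategory.braiding_naturality_left_assoc,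
    BraidedCategory.braiding_naturality_left_assoc, cancel_epi] at h
  rw [MonoidalClosed.uncurry_eq, MonoidalClosed.uncurry_eq, h]

variable (X) in
/-- Evaluation of a path at the endpoint `e` of `Δ[1]`. -/
noncomputable def pathEnd (e : Bool) : pathSpace X ⟶ X :=
  cylinderEnd e _ ≫ pathEval X

theorem comp_pathEnd (e : Bool) {A : SSet.{w}} (g : A ⟶ pathSpace X) :
    g ≫ pathEnd X e = cylinderEnd e A ≫ g ▷ Δ[1] ≫ pathEval X := by
  rw [pathEnd, ← Category.assoc, ← cylinderEnd_whiskerRight, Category.assoc]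

variable (X) in
/-- For a Kan complex, the endpoint map on paths is a trivial fibration. -/
theorem rlp_pathEnd [X.KanComplex] (e : Bool) :
    (MorphismProperty.monomorphisms SSet.{w}).rlp (pathEnd X e) := by
  intro A B i hi
  have : Mono i := hi
  refine ⟨fun {g f} sq => ?_⟩
  obtain ⟨l, hl₁, hl₂⟩ := exists_cylinder_extension e i f (g ▷ Δ[1] ≫ pathEval X)
    (by rw [← comp_pathEnd, sq.w])
  refine ⟨⟨⟨toPath l, ?_, ?_⟩⟩⟩
  · apply toPath_unique
    rw [comp_whiskerRight, Category.assoc, toPath_whiskerRight, hl₂]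
  · rw [comp_pathEnd, toPath_whiskerRight, hl₁]

theorem comp_toPath {A A' : SSet.{w}} (a : A' ⟶ A) (h : A ⊗ Δ[1] ⟶ X) :
    toPath (a ▷ Δ[1] ≫ h) = a ≫ toPath h := by
  apply toPath_unique
  rw [toPath_whiskerRight, comp_whiskerRight, Category.assoc, toPath_whiskerRight]

theorem toPath_comp_pathEnd {e : Bool} {A B : SSet.{w}} {i : A ⟶ B} {f : B ⟶ X}
    {h : A ⊗ Δ[1] ⟶ X} (hfh : i ≫ f = cylinderEnd e A ≫ h) :
    toPath h ≫ pathEnd X e = i ≫ f := by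
  rw [comp_pathEnd, toPath_whiskerRight, hfh]

/-- Lifts against pushout-products with an endpoint of `Δ[1]` correspond to lifts against the
endpoint map on paths, and the latter can be chosen uniformly. -/
theorem isUniformKanComplex [X.KanComplex] : IsUniformKanComplex X :=
  ⟨{
    lift := fun e _ _ i _ f h _ h₁ _ _ =>
      SSet.uniformLift i (toPath h) f (rlp_pathEnd X e) (toPath_comp_pathEnd h₁) ▷ Δ[1] ≫
        pathEval X
    end_lift := fun e _ _ i _ f h _ h₁ _ _ => by
      rw [← comp_pathEnd, SSet.uniformLift_comp]
    whisker_lift := fun e _ _ i _ f h _ h₁ _ _ => by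
      rw [← Category.assoc, ← comp_whiskerRight, SSet.comp_uniformLift, toPath_whiskerRight]
    lift_comp := fun _ _ _ _ _ _ _ _ _ _ _ => Subsingleton.elim _ _
    uniform := fun e _ _ _ _ i _ i' _ a b sq f h _ h₁ _ _ h₁' _ _ => by
      have h' : (a ≫ toPath h) ≫ pathEnd X e = i' ≫ b ≫ f := by
        rw [Category.assoc, toPath_comp_pathEnd h₁, ← Category.assoc, sq.w, Category.assoc]
      have := SSet.uniformLift_pullback i (toPath h) f (rlp_pathEnd X e)
        (toPath_comp_pathEnd h₁) i' sq h'
      simp only [comp_toPath]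
      rw [this, comp_whiskerRight, Category.assoc] }⟩

end KanNotions

theorem mainTheorem3 (T : AlgebraicTheory.{u}) :
    List.TFAE [
      T.IsMalcev,
      ∀ X : AlgebraicTheory.SimplicialAlgebra.{u, max u w} T,
        KanNotions.IsDegeneratePreferringKanComplex (AlgebraicTheory.underlying X),
      ∀ X : AlgebraicTheory.SimplicialAlgebra.{u, max u w} T,
        SSet.KanComplex (AlgebraicTheory.underlying X),
      ∀ X : AlgebraicTheory.SimplicialAlgebra.{u, max u w} T,
        KanNotions.IsUniformKanComplex (AlgebraicTheory.underlying X),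
      ∀ X : AlgebraicTheory.SimplicialAlgebra.{u, max u w} T,
        KanNotions.IsSymmetricEffectiveKanComplex (AlgebraicTheory.underlying X),
      ∀ X : AlgebraicTheory.SimplicialAlgebra.{u, max u w} T,
        KanNotions.IsEffectiveKanComplex (AlgebraicTheory.underlying X)] := by
  tfae_have 1 → 3 := fun hT X => (hT.nonempty_malcevOperation X).some.kanComplex
  tfae_have 3 → 2 := fun h X =>
    have := h X
    KanNotions.isDegeneratePreferringKanComplex
  tfae_have 2 → 5 := fun h X =>
    let ⟨F, hF⟩ := h X
    ⟨F, hF.isSymmetricEffective⟩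
  tfae_have 2 → 6 := fun h X =>
    let ⟨F, hF⟩ := h X
    ⟨F.toSigned, hF.isEffective_toSigned⟩
  tfae_have 5 → 3 := fun h X =>
    let ⟨F, _⟩ := h X
    F.kanComplex
  tfae_have 6 → 3 := fun h X =>
    let ⟨F, _⟩ := h X
    F.kanComplex
  tfae_have 3 → 4 := fun h X =>
    have := h X
    KanNotions.isUniformKanComplex
  tfae_have 3 → 1 := fun h =>
    have := h (AlgebraicTheory.freeSimplicial.{u, w} T (SSet.horn.{0} 2 1))
    AlgebraicTheory.isMalcev_of_hasTriangles T SSet.hasTriangles_of_kanComplex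
  tfae_have 4 → 1 := fun h =>
    AlgebraicTheory.isMalcev_of_hasTriangles.{u, w} T
      (SSet.hasTriangles_of_isUniformKanComplex (h _))
  tfae_finish
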